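/- All graphs are finite and simple. The $1$-subdivision $T^{(1)}$ of a graph $T$ is obtained by replacing each edge of $T$ by a path of length $2$. A graph is $F$-free if it has no (not necessarily induced) subgraph isomorphic to $F$. An acyclic colouring of a graph $G$ is a proper vertex colouring in which the union of any two colour classes induces a forest, and the acyclic chromatic number $\chi_a(G)$ is the minimum number of colours in an acyclic colouring of $G$. For a graph $F$ and an integer $d\ge 0$, let $a(d,F)$ be the maximum of $\chi_a(G)$ over all $F$-free graphs $G$ of maximum degree at most $d$ (any bound on $a(d,F)$ being understood as vacuous if there is no such $G$). Theorem. Let $F$ be a graph that is isomorphic to a subgraph of $T^{(1)}$ for some tree $T$. Then there is a constant $c_F$ such that every $F$-free graph $G$, of whatever maximum degree, satisfies $\chi_a(G)\le c_F$; in particular $a(d,F)\le c_F$ for all $d\ge 0$. -/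

import Mathlib

namespace SimpleGraph

universe u

/-- The `1`-subdivision `G^{(1)}` of a graph `G`: every edge is replaced by a path of length `2`.
Its vertices are the vertices of `G` together with one new vertex for each edge of `G`, and
the new vertex of an edge `e` is adjacent to exactly the two ends of `e`. -/
def oneSubdivision {V : Type u} (G : SimpleGraph V) : SimpleGraph (V ⊕ G.edgeSet) where
  Adj
    | .inl v, .inr e => v ∈ (e : Sym2 V)
    | .inr e, .inl v => v ∈ (e : Sym2 V)
    | _, _ => False
  symm := by
    constructor
    rintro (v | e) (w | f) h
    exacts [h, h, h, h]
  loopless := by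
    constructor
    rintro (v | e) h
    exacts [h, h]

/-- A proper colouring is acyclic if every pair of colour classes induces a forest. -/
def Coloring.IsAcyclicColoring {V : Type u} {G : SimpleGraph V} {α : Type*}
    (φ : G.Coloring α) : Prop :=
  ∀ a b : α, (G.induce {v | φ v = a ∨ φ v = b}).IsAcyclic

/-- `G` has an acyclic colouring with (at most) `k` colours. -/
def AcyclicColorable {V : Type u} (G : SimpleGraph V) (k : ℕ) : Prop :=
  ∃ φ : G.Coloring (Fin k), φ.IsAcyclicColoring

/-- The acyclic chromatic number `χ_a(G)`: the least `k` such that `G` has an acyclic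
`k`-colouring (and `⊤` if there is none, which never happens for a finite graph). -/
noncomputable def acyclicChromaticNumber {V : Type u} (G : SimpleGraph V) : ℕ∞ :=
  ⨅ k ∈ {k : ℕ | G.AcyclicColorable k}, (k : ℕ∞)

open scoped Classical in
/-- `a(d, F)`: the largest acyclic chromatic number of a finite `F`-free graph of maximum degree
at most `d`, as a supremum in `ℕ∞`. Every finite graph is isomorphic to one on some `Fin n`. -/
noncomputable def maxAcyclicChromaticNumber {W : Type u} (d : ℕ) (F : SimpleGraph W) : ℕ∞ :=
  sSup {x : ℕ∞ | ∃ (n : ℕ) (G : SimpleGraph (Fin n)),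
    F.Free G ∧ G.maxDegree ≤ d ∧ x = G.acyclicChromaticNumber}

end SimpleGraph

namespace SimpleGraph

open Finset
open scoped Classical

/-! It suffices to exclude the 1-subdivision of `T`. Vertices are eliminated one by one and coloured
greedily in reverse. When `v` leaves the remaining set `S`, its colour avoids those of its
neighbours in `S` and of the vertices of `S` reached from it by two-step paths through eliminated
vertices. In any cycle, the first eliminated vertex `z` has two cycle neighbours, which leave later:
they get different colours because of the path through `z`, and both differ from `z`. So no cycle is
two-coloured (`exists_greedy_coloring`).

A vertex with boundedly many colours to avoid exists by averaging. The degree sum in `S` is linear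
because the subdivision embeds greedily otherwise. For two-step paths, take a maximal set of pairs
in `S` with distinct eliminated middles: these pairs form a graph without a copy of `T`, hence are
linearly many, and they account for all two-step paths up to a bounded factor
(`sum_card_twoStepIn_le`). -/

/-! ### One-degeneracy of trees and their subdivisions -/

/-- Every nonempty finite set of vertices contains a vertex with at most one neighbour in it. -/
def IsOneDegenerate {U : Type*} (P : SimpleGraph U) : Prop :=
  ∀ X : Finset U, X.Nonempty →
    ∃ v ∈ X, ∀ x ∈ X, ∀ y ∈ X, P.Adj v x → P.Adj v y → x = y

/-- The neighbours of `v` in the finite set `S`. -/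
noncomputable def nbrsIn {V : Type*} (G : SimpleGraph V) (S : Finset V) (v : V) : Finset V :=
  {x ∈ S | G.Adj v x}

@[simp]
lemma mem_nbrsIn {V : Type*} {G : SimpleGraph V} {S : Finset V} {v x : V} :
    x ∈ G.nbrsIn S v ↔ x ∈ S ∧ G.Adj v x := by
  simp [nbrsIn]

lemma nbrsIn_mono {V : Type*} (G : SimpleGraph V) {S S' : Finset V} (h : S ⊆ S') (v : V) :
    G.nbrsIn S v ⊆ G.nbrsIn S' v :=
  Finset.filter_subset_filter _ h

/-- Root the tree at `r`. A vertex of `X` farthest from `r` can have only its parent as a neighbour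
in `X`, since any other neighbour is farther from `r`. -/
lemma IsTree.isOneDegenerate {U : Type*} {T : SimpleGraph U} (hT : T.IsTree) :
    T.IsOneDegenerate := by
  intro X hX
  obtain ⟨r⟩ := hT.connected.nonempty
  obtain ⟨v, hv, hmax⟩ := X.exists_max_image (T.dist r) hX
  obtain ⟨p, hp, hp'⟩ := (hT.connected r v).exists_path_of_dist
  have key : ∀ x ∈ X, T.Adj v x → x = p.penultimate := by
    intro x hx hvx
    refine hT.isAcyclic.eq_penultimate_of_adj_end hp hvx ?_
    by_contra hxp
    obtain ⟨q, hq, hq'⟩ := (hT.connected r x).exists_path_of_dist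
    have hvq := hT.isAcyclic.mem_support_of_ne_mem_support_of_adj_of_isPath hq hp hvx.symm hxp
    have hlen := congrArg Walk.length (hT.isAcyclic.path_concat hp hq hvx hvq)
    rw [Walk.length_concat] at hlen
    have := hmax x hx
    omega
  exact ⟨v, hv, fun x hx y hy hvx hvy ↦ (key x hx hvx).trans (key y hy hvy).symm⟩

/-- A subdivision vertex in `X` that misses one of its ends will do. If there is none, a vertex
chosen by `hT` among the original vertices in `X` will do, since each subdivision vertex next to it
brings its other end into `X`. -/
lemma IsOneDegenerate.oneSubdivision {U : Type*} {T : SimpleGraph U} (hT : T.IsOneDegenerate) :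
    T.oneSubdivision.IsOneDegenerate := by
  intro X hX
  by_cases hE : ∃ e : T.edgeSet, Sum.inr e ∈ X ∧ ∃ u ∈ (e : Sym2 U), Sum.inl u ∉ X
  · obtain ⟨⟨e, he⟩, heX, u, hu, huX⟩ := hE
    obtain ⟨w, rfl⟩ := Sym2.mem_iff_exists.mp hu
    have key : ∀ x ∈ X, T.oneSubdivision.Adj (.inr ⟨s(u, w), he⟩) x → x = .inl w := by
      rintro (x | x) hx hadj
      · obtain rfl | rfl := Sym2.mem_iff.mp (show x ∈ s(u, w) from hadj)
        · exact absurd hx huX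
        · rfl
      · exact hadj.elim
    exact ⟨_, heX, fun x hx y hy h h' ↦ (key x hx h).trans (key y hy h').symm⟩
  · push Not at hE
    obtain ⟨A, hA⟩ : ∃ A : Finset U, ∀ u, u ∈ A ↔ Sum.inl u ∈ X :=
      ⟨X.preimage Sum.inl Sum.inl_injective.injOn, by simp⟩
    have hAne : A.Nonempty := by
      obtain ⟨u | ⟨e, he⟩, hx⟩ := hX
      · exact ⟨u, (hA u).2 hx⟩
      · induction e with
        | h a b => exact ⟨a, (hA a).2 (hE _ hx a (Sym2.mem_mk_left a b))⟩
    obtain ⟨v, hv, hv'⟩ := hT A hAne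
    refine ⟨.inl v, (hA v).1 hv, ?_⟩
    rintro (x | ⟨e, he⟩) hx (y | ⟨f, hf⟩) hy h h'
    · exact h.elim
    · exact h.elim
    · exact h'.elim
    · obtain ⟨a, rfl⟩ := Sym2.mem_iff_exists.mp (show v ∈ e from h)
      obtain ⟨b, rfl⟩ := Sym2.mem_iff_exists.mp (show v ∈ f from h')
      have := hv' a ((hA a).2 (hE _ hx a (Sym2.mem_mk_right v a)))
        b ((hA b).2 (hE _ hy b (Sym2.mem_mk_right v b))) he hf
      subst this
      rfl

/-! ### Greedy embedding and linear edge bounds -/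

/-- A `1`-degenerate graph embeds greedily in a nonempty vertex set of large minimum degree. -/
lemma IsOneDegenerate.exists_copy_in {U V : Type*} [Fintype U] {P : SimpleGraph U}
    (hP : P.IsOneDegenerate) (G : SimpleGraph V) {S : Finset V} (hS : S.Nonempty)
    (hdeg : ∀ v ∈ S, Fintype.card U ≤ #(G.nbrsIn S v)) :
    ∃ f : U → V, Function.Injective f ∧ (∀ u, f u ∈ S) ∧ ∀ u u', P.Adj u u' → G.Adj (f u) (f u') := by
  suffices H : ∀ X : Finset U, ∃ f : U → V, Set.InjOn f X ∧ (∀ u ∈ X, f u ∈ S) ∧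
      ∀ u ∈ X, ∀ u' ∈ X, P.Adj u u' → G.Adj (f u) (f u') by
    obtain ⟨f, h1, h2, h3⟩ := H univ
    exact ⟨f, fun a b h ↦ h1 (by simp) (by simp) h, by simpa using h2, by simpa using h3⟩
  intro X
  induction hn : #X generalizing X with
  | zero =>
    obtain rfl := Finset.card_eq_zero.mp hn
    exact ⟨fun _ ↦ hS.choose, by simp, by simp, by simp⟩
  | succ n ih =>
    obtain ⟨v, hv, hv'⟩ := hP X (Finset.card_pos.mp (by omega))
    obtain ⟨f, hinj, hfS, hadj⟩ := ih (X.erase v) (by rw [card_erase_of_mem hv]; omega)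
    have hlt : #((X.erase v).image f) < Fintype.card U := by
      refine card_image_le.trans_lt ?_
      rw [card_erase_of_mem hv, hn]
      have := X.card_le_univ
      omega
    obtain ⟨z, hzS, hznew, hzadj⟩ : ∃ z ∈ S, z ∉ (X.erase v).image f ∧
        ∀ u ∈ X, P.Adj v u → G.Adj z (f u) := by
      -- At most one neighbour `u` of `v` is already embedded, so any unused neighbour of `f u` can
      -- serve as the image of `v`.
      by_cases hu : ∃ u ∈ X, P.Adj v u
      · obtain ⟨u, hu, hvu⟩ := hu
        obtain ⟨z, hz, hz'⟩ := exists_mem_notMem_of_card_lt_card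
          (hlt.trans_le (hdeg (f u) (hfS u (mem_erase.2 ⟨hvu.ne', hu⟩))))
        rw [mem_nbrsIn] at hz
        refine ⟨z, hz.1, hz', fun u' hu' hvu' ↦ ?_⟩
        rw [hv' u' hu' u hu hvu' hvu]
        exact hz.2.symm
      · obtain ⟨s, hs⟩ := hS
        obtain ⟨z, hz, hz'⟩ := exists_mem_notMem_of_card_lt_card (hlt.trans_le (hdeg s hs))
        rw [mem_nbrsIn] at hz
        exact ⟨z, hz.1, hz', fun u hu' hvu ↦ (hu ⟨u, hu', hvu⟩).elim⟩
    have hne : ∀ u ∈ X, u ≠ v → f u ≠ z := fun u hu huv h ↦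
      hznew (mem_image.2 ⟨u, mem_erase.2 ⟨huv, hu⟩, h⟩)
    refine ⟨Function.update f v z, ?_, ?_, ?_⟩
    · intro a ha b hb hab
      rw [mem_coe] at ha hb
      by_cases hav : a = v <;> by_cases hbv : b = v
      · rw [hav, hbv]
      · subst hav
        rw [Function.update_self, Function.update_of_ne hbv] at hab
        exact (hne b hb hbv hab.symm).elim
      · subst hbv
        rw [Function.update_self, Function.update_of_ne hav] at hab
        exact (hne a ha hav hab).elim
      · rw [Function.update_of_ne hav, Function.update_of_ne hbv] at hab
        exact hinj (by simp [hav, ha]) (by simp [hbv, hb]) hab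
    · intro u hu
      by_cases huv : u = v
      · rw [huv, Function.update_self]
        exact hzS
      · rw [Function.update_of_ne huv]
        exact hfS u (mem_erase.2 ⟨huv, hu⟩)
    · intro a ha b hb hab
      by_cases hav : a = v
      · subst hav
        rw [Function.update_self, Function.update_of_ne hab.ne']
        exact hzadj b hb hab
      · by_cases hbv : b = v
        · subst hbv
          rw [Function.update_self, Function.update_of_ne hav]
          exact (hzadj a ha hab.symm).symm
        · rw [Function.update_of_ne hav, Function.update_of_ne hbv]
          exact hadj a (mem_erase.2 ⟨hav, ha⟩) b (mem_erase.2 ⟨hbv, hb⟩) hab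

lemma sum_card_nbrsIn_erase {V : Type*} (G : SimpleGraph V) {S : Finset V} {v : V} (hv : v ∈ S) :
    ∑ x ∈ S, #(G.nbrsIn S x) =
      ∑ x ∈ S.erase v, #(G.nbrsIn (S.erase v) x) + 2 * #(G.nbrsIn S v) := by
  have h1 : ∀ x ∈ S.erase v, #(G.nbrsIn S x) =
      #(G.nbrsIn (S.erase v) x) + if G.Adj v x then 1 else 0 := by
    intro x hx
    by_cases h : G.Adj v x
    · have : G.nbrsIn (S.erase v) x = (G.nbrsIn S x).erase v := by
        ext y
        simp only [mem_nbrsIn, mem_erase]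
        tauto
      rw [if_pos h, this, card_erase_add_one]
      exact mem_nbrsIn.2 ⟨hv, h.symm⟩
    · rw [if_neg h, add_zero]
      congr 1
      ext y
      simp only [mem_nbrsIn, mem_erase]
      constructor
      · rintro ⟨hy, hxy⟩
        exact ⟨⟨fun hyv ↦ h (hyv ▸ hxy.symm), hy⟩, hxy⟩
      · tauto
  have h2 : ∑ x ∈ S.erase v, (if G.Adj v x then 1 else 0) = #(G.nbrsIn S v) := by
    rw [← card_filter]
    congr 1
    ext y
    simp only [mem_filter, mem_nbrsIn, mem_erase]
    constructor
    · tauto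
    · rintro ⟨hy, hvy⟩
      exact ⟨⟨hvy.ne', hy⟩, hvy⟩
  rw [← sum_erase_add _ _ hv, sum_congr rfl h1, sum_add_distrib, h2]
  ring

/-- If a `1`-degenerate graph does not embed in `S`, then `S` spans linearly many edges. -/
lemma IsOneDegenerate.sum_card_nbrsIn_le {U V : Type*} [Fintype U] {P : SimpleGraph U}
    (hP : P.IsOneDegenerate) (G : SimpleGraph V) (S : Finset V)
    (hfree : ¬ ∃ f : U → V, Function.Injective f ∧ (∀ u, f u ∈ S) ∧
      ∀ u u', P.Adj u u' → G.Adj (f u) (f u')) :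
    ∑ v ∈ S, #(G.nbrsIn S v) ≤ 2 * Fintype.card U * #S := by
  induction hn : #S generalizing S with
  | zero => simp [Finset.card_eq_zero.mp hn]
  | succ n ih =>
    obtain ⟨v, hv, hlt⟩ : ∃ v ∈ S, #(G.nbrsIn S v) < Fintype.card U := by
      by_contra! h
      exact hfree (hP.exists_copy_in G (card_pos.mp (by omega)) h)
    have := ih (S.erase v)
      (fun ⟨f, h1, h2, h3⟩ ↦ hfree ⟨f, h1, fun u ↦ mem_of_mem_erase (h2 u), h3⟩)
      (by rw [card_erase_of_mem hv]; omega)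
    rw [sum_card_nbrsIn_erase G hv]
    linarith

/-! ### Counting two-step paths through eliminated vertices -/

/-- The vertices of `S` joined to `v` by a path of length two through a vertex outside `S`. -/
noncomputable def twoStepIn {V : Type*} (G : SimpleGraph V) (S : Finset V) (v : V) : Finset V :=
  {x ∈ S | x ≠ v ∧ ∃ w ∉ S, G.Adj w v ∧ G.Adj w x}

@[simp]
lemma mem_twoStepIn {V : Type*} {G : SimpleGraph V} {S : Finset V} {v x : V} :
    x ∈ G.twoStepIn S v ↔ x ∈ S ∧ x ≠ v ∧ ∃ w ∉ S, G.Adj w v ∧ G.Adj w x := by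
  simp [twoStepIn]

/-- `μ` assigns to the pairs in `E` of vertices of `S` distinct common neighbours outside `S`. -/
structure IsMiddleAssignment {V : Type*} (G : SimpleGraph V) (S : Finset V)
    (E : Finset (Sym2 V)) (μ : Sym2 V → V) : Prop where
  mem : ∀ e ∈ E, ∀ v ∈ e, v ∈ S
  not_diag : ∀ e ∈ E, ¬ e.IsDiag
  notMem : ∀ e ∈ E, μ e ∉ S
  adj : ∀ e ∈ E, ∀ v ∈ e, G.Adj (μ e) v
  injOn : Set.InjOn μ E

lemma IsMiddleAssignment.isContained_oneSubdivision {U V : Type*} {T : SimpleGraph U}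
    {G : SimpleGraph V} {S : Finset V} {E : Finset (Sym2 V)} {μ : Sym2 V → V}
    (h : G.IsMiddleAssignment S E μ) {f : U → V} (hf : Function.Injective f)
    (hfS : ∀ u, f u ∈ S) (hadj : ∀ u u', T.Adj u u' → s(f u, f u') ∈ E) :
    T.oneSubdivision.IsContained G := by
  have hE : ∀ e ∈ T.edgeSet, e.map f ∈ E := by
    intro e
    induction e with
    | h a b => exact hadj a b
  let g : U ⊕ T.edgeSet → V := Sum.elim f fun e ↦ μ ((e : Sym2 U).map f)
  refine ⟨⟨⟨g, ?_⟩, ?_⟩⟩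
  · rintro (v | ⟨e, he⟩) (w | ⟨e', he'⟩) hvw
    · exact hvw.elim
    · exact (h.adj _ (hE e' he') _ (Sym2.mem_map.2 ⟨v, hvw, rfl⟩)).symm
    · exact h.adj _ (hE e he) _ (Sym2.mem_map.2 ⟨w, hvw, rfl⟩)
    · exact hvw.elim
  · rintro (v | ⟨e, he⟩) (w | ⟨e', he'⟩) hvw
    · exact congrArg _ (hf hvw)
    · exact (h.notMem _ (hE e' he') ((show f v = μ (e'.map f) from hvw) ▸ hfS v)).elim
    · exact (h.notMem _ (hE e he) ((show μ (e.map f) = f w from hvw) ▸ hfS w)).elim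
    · have := Sym2.map.injective hf (h.injOn (hE e he) (hE e' he') hvw)
      subst this
      rfl

/-- In an assignment with the most pairs, an unused `w` cannot be the middle of a new pair, so all
pairs of its neighbours in `S` are already present. -/
lemma exists_maximal_isMiddleAssignment {V : Type*} [Fintype V] (G : SimpleGraph V)
    (S : Finset V) : ∃ E μ, G.IsMiddleAssignment S E μ ∧
      ∀ w ∉ S, w ∉ E.image μ → ∀ v ∈ S, ∀ x ∈ S, x ≠ v → G.Adj w v → G.Adj w x →
        s(v, x) ∈ E := by
  have hne : ({E | ∃ μ, G.IsMiddleAssignment S E μ} : Finset (Finset (Sym2 V))).Nonempty :=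
    -- `V` may be empty, so the irrelevant value of the assignment is taken from `e` itself.
    ⟨∅, mem_filter.2 ⟨mem_univ _, fun e ↦ (Quot.out e).1,
      ⟨by simp, by simp, by simp, by simp, by simp⟩⟩⟩
  obtain ⟨E, hE, hmax⟩ := exists_max_image _ Finset.card hne
  obtain ⟨μ, hμ⟩ := (mem_filter.1 hE).2
  refine ⟨E, μ, hμ, fun w hw hwE v hv x hx hxv hwv hwx ↦ ?_⟩
  by_contra hvx
  have hupd : ∀ e ∈ E, Function.update μ s(v, x) w e = μ e := fun e he ↦
    Function.update_of_ne (fun h : e = s(v, x) ↦ hvx (h ▸ he)) _ _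
  have hnew : ∀ e ∈ E, μ e ≠ w := fun e he h ↦ hwE (mem_image.2 ⟨e, he, h⟩)
  have hassign : G.IsMiddleAssignment S (insert s(v, x) E) (Function.update μ s(v, x) w) := by
    constructor
    · intro e he u hu
      obtain rfl | he := mem_insert.1 he
      · obtain rfl | rfl := Sym2.mem_iff.1 hu <;> assumption
      · exact hμ.mem e he u hu
    · intro e he
      obtain rfl | he := mem_insert.1 he
      · simpa using hxv.symm
      · exact hμ.not_diag e he
    · intro e he
      obtain rfl | he := mem_insert.1 he
      · simpa using hw
      · rw [hupd e he]
        exact hμ.notMem e he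
    · intro e he u hu
      obtain rfl | he := mem_insert.1 he
      · rw [Function.update_self]
        obtain rfl | rfl := Sym2.mem_iff.1 hu <;> assumption
      · rw [hupd e he]
        exact hμ.adj e he u hu
    · intro e he e' he' hee
      obtain rfl | he := mem_insert.1 he <;> obtain rfl | he' := mem_insert.1 he'
      · rfl
      · rw [Function.update_self, hupd e' he'] at hee
        exact (hnew e' he' hee.symm).elim
      · rw [Function.update_self, hupd e he] at hee
        exact (hnew e he hee).elim
      · rw [hupd e he, hupd e' he'] at hee
        exact hμ.injOn he he' hee
  have := hmax _ (mem_filter.2 ⟨mem_univ _, _, hassign⟩)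
  rw [card_insert_of_notMem hvx] at this
  omega

/-- If `T` is `1`-degenerate, `G` does not contain the `1`-subdivision of `T`, and every vertex
outside `S` has at most `C` neighbours in `S`, then on average a vertex of `S` reaches few others
in two steps through the outside. -/
lemma sum_card_twoStepIn_le {U V : Type*} [Fintype U] [Fintype V] {T : SimpleGraph U}
    (hT : T.IsOneDegenerate) {G : SimpleGraph V} (hG : T.oneSubdivision.Free G)
    {S : Finset V} {C : ℕ} (hC : ∀ w ∉ S, #(G.nbrsIn S w) ≤ C) :
    ∑ v ∈ S, #(G.twoStepIn S v) ≤ 2 * Fintype.card U * (1 + C * C) * #S := by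
  obtain ⟨E, μ, hμ, hmax⟩ := G.exists_maximal_isMiddleAssignment S
  let H : SimpleGraph V := fromEdgeSet E
  have hH : ∑ v ∈ S, #(H.nbrsIn S v) ≤ 2 * Fintype.card U * #S := by
    refine hT.sum_card_nbrsIn_le H S fun ⟨f, hf, hfS, hadj⟩ ↦ hG ?_
    exact hμ.isContained_oneSubdivision hf hfS
      fun u u' h ↦ ((fromEdgeSet_adj _).1 (hadj u u' h)).1
  have hE : #E ≤ 2 * Fintype.card U * #S := by
    refine le_trans ?_ hH
    rw [← card_sigma]
    refine card_le_card_of_surjOn (fun p ↦ s(p.1, p.2)) fun e ↦ ?_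
    induction e with
    | h a b =>
      intro he
      rw [mem_coe] at he
      have ha := hμ.mem _ he a (Sym2.mem_mk_left a b)
      have hb := hμ.mem _ he b (Sym2.mem_mk_right a b)
      have hab : a ≠ b := by simpa using hμ.not_diag _ he
      exact ⟨⟨a, b⟩, by simp [H, ha, hb, he, hab], rfl⟩
  have hv : ∀ v ∈ S, #(G.twoStepIn S v) ≤
      #(H.nbrsIn S v) + ∑ e ∈ E, if G.Adj (μ e) v then C else 0 := by
    intro v hv
    have hsub : G.twoStepIn S v ⊆
        H.nbrsIn S v ∪ {e ∈ E | G.Adj (μ e) v}.biUnion fun e ↦ G.nbrsIn S (μ e) := by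
      intro x hx
      obtain ⟨hxS, hxv, w, hw, hwv, hwx⟩ := mem_twoStepIn.1 hx
      by_cases hwE : w ∈ E.image μ
      · obtain ⟨e, he, rfl⟩ := mem_image.1 hwE
        exact mem_union_right _ (mem_biUnion.2
          ⟨e, mem_filter.2 ⟨he, hwv⟩, mem_nbrsIn.2 ⟨hxS, hwx⟩⟩)
      · exact mem_union_left _ (mem_nbrsIn.2 ⟨hxS, (fromEdgeSet_adj _).2
          ⟨hmax w hw hwE v hv x hxS hxv hwv hwx, hxv.symm⟩⟩)
    refine (card_le_card hsub).trans ((card_union_le _ _).trans (Nat.add_le_add_left ?_ _))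
    refine card_biUnion_le.trans ?_
    rw [← sum_filter]
    exact sum_le_sum fun e he ↦ hC _ (hμ.notMem e (mem_filter.1 he).1)
  -- Each used middle has at most `C` neighbours `v` in `S` and is charged `C` for each of them.
  have hsum : ∑ v ∈ S, ∑ e ∈ E, (if G.Adj (μ e) v then C else 0) ≤ #E * (C * C) := by
    rw [sum_comm, ← smul_eq_mul]
    refine sum_le_card_nsmul _ _ _ fun e he ↦ ?_
    rw [← sum_filter, sum_const, smul_eq_mul]
    exact Nat.mul_le_mul_right _ (hC _ (hμ.notMem e he))
  calc ∑ v ∈ S, #(G.twoStepIn S v)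
      ≤ ∑ v ∈ S, #(H.nbrsIn S v) + ∑ v ∈ S, ∑ e ∈ E, (if G.Adj (μ e) v then C else 0) := by
        rw [← sum_add_distrib]
        exact sum_le_sum hv
    _ ≤ 2 * Fintype.card U * #S + 2 * Fintype.card U * #S * (C * C) :=
        Nat.add_le_add hH (hsum.trans (Nat.mul_le_mul_right _ hE))
    _ = _ := by ring

/-- By Markov's inequality, each of the two bounds fails on fewer than half of `S`. -/
lemma exists_le_two_mul_of_sum_le {V : Type*} {S : Finset V} (hS : S.Nonempty) {f g : V → ℕ}
    {a b : ℕ} (hf : ∑ v ∈ S, f v ≤ a * #S) (hg : ∑ v ∈ S, g v ≤ b * #S) :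
    ∃ v ∈ S, f v ≤ 2 * a ∧ g v ≤ 2 * b := by
  by_contra! h
  have h1 : (2 * a + 1) * #{v ∈ S | 2 * a < f v} ≤ a * #S := by
    refine le_trans ?_ hf
    rw [mul_comm, ← smul_eq_mul]
    exact (card_nsmul_le_sum _ _ _ fun v hv ↦ (mem_filter.1 hv).2).trans
      (sum_le_sum_of_subset (filter_subset _ _))
  have h2 : (2 * b + 1) * #{v ∈ S | 2 * b < g v} ≤ b * #S := by
    refine le_trans ?_ hg
    rw [mul_comm, ← smul_eq_mul]
    exact (card_nsmul_le_sum _ _ _ fun v hv ↦ (mem_filter.1 hv).2).trans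
      (sum_le_sum_of_subset (filter_subset _ _))
  have h3 : #S ≤ #{v ∈ S | 2 * a < f v} + #{v ∈ S | 2 * b < g v} := by
    refine (card_le_card fun v hv ↦ ?_).trans (card_union_le _ _)
    by_cases hfv : 2 * a < f v
    · exact mem_union_left _ (mem_filter.2 ⟨hv, hfv⟩)
    · exact mem_union_right _ (mem_filter.2 ⟨hv, h v hv (not_lt.1 hfv)⟩)
  have hpos := hS.card_pos
  have half : ∀ c s n : ℕ, 0 < n → (2 * c + 1) * s ≤ c * n → 2 * s < n := by
    intro c s n hn hs
    by_contra! hcon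
    nlinarith
  have := half _ _ _ hpos h1
  have := half _ _ _ hpos h2
  omega

/-! ### Greedy colouring and acyclicity -/

/-- A vertex set in which every vertex has two distinct neighbours. -/
def HasTwoNeighbors {V : Type*} (G : SimpleGraph V) (Z : Finset V) : Prop :=
  ∀ z ∈ Z, ∃ x ∈ Z, ∃ y ∈ Z, x ≠ y ∧ G.Adj z x ∧ G.Adj z y

/-- Greedy colouring along an elimination ordering in which every vertex is adjacent to, or joined
through previously eliminated vertices to, few of the remaining vertices. -/
lemma exists_greedy_coloring {V : Type*} (G : SimpleGraph V) {C D : ℕ}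
    (hel : ∀ S : Finset V, S.Nonempty → (∀ w ∉ S, #(G.nbrsIn S w) ≤ C) →
      ∃ v ∈ S, #(G.nbrsIn S v) ≤ C ∧ #(G.twoStepIn S v) ≤ D)
    (S : Finset V) (hS : ∀ w ∉ S, #(G.nbrsIn S w) ≤ C) :
    ∃ φ : V → Fin (C + D + 1),
      (∀ x ∈ S, ∀ y ∈ S, G.Adj x y → φ x ≠ φ y) ∧
      (∀ x ∈ S, ∀ y ∈ S, x ≠ y → (∃ w ∉ S, G.Adj w x ∧ G.Adj w y) → φ x ≠ φ y) ∧
      ∀ Z ⊆ S, Z.Nonempty → G.HasTwoNeighbors Z →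
        ∀ a b, ∃ z ∈ Z, φ z ≠ a ∧ φ z ≠ b := by
  induction hn : #S generalizing S with
  | zero =>
    obtain rfl := Finset.card_eq_zero.mp hn
    exact ⟨fun _ ↦ 0, by simp, by simp, fun Z hZ hne ↦ (hne.ne_empty (subset_empty.1 hZ)).elim⟩
  | succ n ih =>
    obtain ⟨v, hv, hvC, hvD⟩ := hel S (card_pos.mp (by omega)) hS
    obtain ⟨φ, h1, h2, h3⟩ := ih (S.erase v) (fun w hw ↦ by
      refine (card_le_card (G.nbrsIn_mono (erase_subset v S) w)).trans ?_
      by_cases hwS : w ∈ S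
      · obtain rfl : w = v := by_contra fun h ↦ hw (mem_erase.2 ⟨h, hwS⟩)
        exact hvC
      · exact hS w hwS) (by rw [card_erase_of_mem hv]; omega)
    obtain ⟨c, -, hc⟩ : ∃ c ∈ (univ : Finset (Fin (C + D + 1))),
        c ∉ (G.nbrsIn S v ∪ G.twoStepIn S v).image φ := by
      refine exists_mem_notMem_of_card_lt_card ?_
      refine (card_image_le.trans (card_union_le _ _)).trans_lt ?_
      rw [card_univ, Fintype.card_fin]
      omega
    have hcN : ∀ y ∈ S, G.Adj v y → φ y ≠ c := fun y hy hvy h ↦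
      hc (mem_image.2 ⟨y, mem_union_left _ (mem_nbrsIn.2 ⟨hy, hvy⟩), h⟩)
    have hcT : ∀ y ∈ S, y ≠ v → (∃ w ∉ S, G.Adj w v ∧ G.Adj w y) → φ y ≠ c :=
      fun y hy hyv hw h ↦
        hc (mem_image.2 ⟨y, mem_union_right _ (mem_twoStepIn.2 ⟨hy, hyv, hw⟩), h⟩)
    have hself : Function.update φ v c v = c := Function.update_self v c φ
    have hother : ∀ y, y ≠ v → Function.update φ v c y = φ y := fun y hy ↦
      Function.update_of_ne hy c φ
    refine ⟨Function.update φ v c, ?_, ?_, ?_⟩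
    · intro x hx y hy hxy
      by_cases hxv : x = v
      · subst hxv
        rw [hself, hother y hxy.ne']
        exact (hcN y hy hxy).symm
      · by_cases hyv : y = v
        · subst hyv
          rw [hself, hother x hxv]
          exact hcN x hx hxy.symm
        · rw [hother x hxv, hother y hyv]
          exact h1 x (mem_erase.2 ⟨hxv, hx⟩) y (mem_erase.2 ⟨hyv, hy⟩) hxy
    · rintro x hx y hy hxy ⟨w, hw, hwx, hwy⟩
      by_cases hxv : x = v
      · subst hxv
        rw [hself, hother y hxy.symm]
        exact (hcT y hy hxy.symm ⟨w, hw, hwx, hwy⟩).symm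
      · by_cases hyv : y = v
        · subst hyv
          rw [hself, hother x hxv]
          exact hcT x hx hxv ⟨w, hw, hwy, hwx⟩
        · rw [hother x hxv, hother y hyv]
          exact h2 x (mem_erase.2 ⟨hxv, hx⟩) y (mem_erase.2 ⟨hyv, hy⟩) hxy
            ⟨w, fun h ↦ hw (mem_of_mem_erase h), hwx, hwy⟩
    · intro Z hZ hne hZ2 a b
      by_cases hvZ : v ∈ Z
      · obtain ⟨x, hx, y, hy, hxy, hvx, hvy⟩ := hZ2 v hvZ
        have hxc := hcN x (hZ hx) hvx
        have hyc := hcN y (hZ hy) hvy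
        -- The vertex `v` is outside `S.erase v`, so `x` and `y` were already coloured differently;
        -- with `c` this makes three colours on `Z`.
        have hxy' := h2 x (mem_erase.2 ⟨hvx.ne', hZ hx⟩) y (mem_erase.2 ⟨hvy.ne', hZ hy⟩) hxy
          ⟨v, notMem_erase v S, hvx, hvy⟩
        by_contra! hcon
        have e1 := hcon v hvZ
        have e2 := hcon x hx
        have e3 := hcon y hy
        rw [hself] at e1
        rw [hother x hvx.ne'] at e2
        rw [hother y hvy.ne'] at e3
        grind
      · obtain ⟨z, hz, hza, hzb⟩ := h3 Z (fun z hz ↦ mem_erase.2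
          ⟨fun h ↦ hvZ (h ▸ hz), hZ hz⟩) hne hZ2 a b
        exact ⟨z, hz, by rwa [hother z fun h ↦ hvZ (h ▸ hz)],
          by rwa [hother z fun h ↦ hvZ (h ▸ hz)]⟩

lemma Walk.IsCycle.hasTwoNeighbors {V : Type*} {G : SimpleGraph V} {u : V} {p : G.Walk u u}
    (hp : p.IsCycle) : G.HasTwoNeighbors p.support.toFinset := by
  intro z hz
  rw [List.mem_toFinset] at hz
  obtain ⟨x, y, hxy, h⟩ := Set.ncard_eq_two.1 (hp.ncard_neighborSet_toSubgraph_eq_two hz)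
  have hx : p.toSubgraph.Adj z x := by
    rw [← Subgraph.mem_neighborSet, h]
    simp
  have hy : p.toSubgraph.Adj z y := by
    rw [← Subgraph.mem_neighborSet, h]
    simp
  exact ⟨x, by simpa using hx.snd_mem, y, by simpa using hy.snd_mem, hxy, hx.adj_sub, hy.adj_sub⟩

lemma Coloring.isAcyclicColoring_of_forall_hasTwoNeighbors {V α : Type*} {G : SimpleGraph V}
    (φ : G.Coloring α) (h : ∀ Z : Finset V, Z.Nonempty → G.HasTwoNeighbors Z →
      ∀ a b, ∃ z ∈ Z, φ z ≠ a ∧ φ z ≠ b) : φ.IsAcyclicColoring := by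
  intro a b u p hp
  have hq := hp.map (f := (Embedding.induce {v | φ v = a ∨ φ v = b}).toHom)
    Subtype.val_injective
  obtain ⟨z, hz, hza, hzb⟩ := h _ ⟨_, List.mem_toFinset.2 (Walk.start_mem_support _)⟩
    hq.hasTwoNeighbors a b
  rw [List.mem_toFinset, Walk.support_map, List.mem_map] at hz
  obtain ⟨y, -, rfl⟩ := hz
  exact y.2.elim hza hzb

/-- The number of colours used for graphs without a copy of the `1`-subdivision of `T`. -/
noncomputable def acyclicBound {U : Type*} [Fintype U] (T : SimpleGraph U) : ℕ :=
  -- Both summands are twice an average bound, as Markov requires; the final `1` leaves a free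
  -- colour.
  let C := 2 * (2 * Fintype.card (U ⊕ T.edgeSet))
  C + 2 * (2 * Fintype.card U * (1 + C * C)) + 1

/-- Graphs without a copy of a fixed `1`-subdivided tree have bounded acyclic chromatic number. -/
theorem IsTree.acyclicChromaticNumber_le {U V : Type*} [Fintype U] [Finite V] {T : SimpleGraph U}
    (hT : T.IsTree) {G : SimpleGraph V} (hG : T.oneSubdivision.Free G) :
    G.acyclicChromaticNumber ≤ T.acyclicBound := by
  have := Fintype.ofFinite V
  obtain ⟨φ, h1, -, h3⟩ := G.exists_greedy_coloring
    (C := 2 * (2 * Fintype.card (U ⊕ T.edgeSet))) (fun S hS hC ↦ exists_le_two_mul_of_sum_le hS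
      (hT.isOneDegenerate.oneSubdivision.sum_card_nbrsIn_le G S fun ⟨f, hf, _, hadj⟩ ↦
        hG ⟨⟨⟨f, fun h ↦ hadj _ _ h⟩, hf⟩⟩)
      (sum_card_twoStepIn_le hT.isOneDegenerate hG hC)) univ (by simp)
  let ψ : G.Coloring (Fin T.acyclicBound) :=
    Coloring.mk φ fun h ↦ h1 _ (mem_univ _) _ (mem_univ _) h
  exact iInf₂_le T.acyclicBound
    ⟨ψ, ψ.isAcyclicColoring_of_forall_hasTwoNeighbors fun Z ↦ h3 Z (subset_univ Z)⟩

end SimpleGraph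

theorem mainTheorem7 {W : Type*} [Finite W] (F : SimpleGraph W)
    {U : Type*} [Finite U] (T : SimpleGraph U) (hT : T.IsTree)
    (hF : F.IsContained T.oneSubdivision) :
    ∃ c : ℕ,
      (∀ (V : Type*) [Finite V] (G : SimpleGraph V),
        F.Free G → G.acyclicChromaticNumber ≤ (c : ℕ∞)) ∧
      ∀ d : ℕ, SimpleGraph.maxAcyclicChromaticNumber d F ≤ (c : ℕ∞) := by
  have := Fintype.ofFinite U
  refine ⟨T.acyclicBound, fun V _ G hG ↦ ?_, fun d ↦ sSup_le ?_⟩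
  · exact hT.acyclicChromaticNumber_le fun h ↦ hG (hF.trans h)
  · rintro _ ⟨n, G, hG, -, rfl⟩
    exact hT.acyclicChromaticNumber_le fun h ↦ hG (hF.trans h)
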